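/- **Setting.** Consider a distribution network whose graph is a tree with nodes $0,1,\dots,N$ and root $0$, with line parameters $r_e,x_e\in\mathbb R$ on each line $e$. For $i,j\in\mathcal N=\{1,\dots,N\}$ let $R_{ij}=\sum 2r_e$ and $X_{ij}=\sum 2x_e$, both sums over the lines common to the paths from $i$ and from $j$ to the root, and let $\mathcal A=[R,\,X]\in\mathbb R^{N\times 2N}$. For each time slot $t\in\mathcal T$ let $d^t=[(p_u^t)^\top,(q_u^t)^\top]^\top\in\mathbb R^{2N}$ be the uncontrollable injections, $v_0^t$ the squared voltage magnitude of the root, and $v_{env}^t=v_0^t\mathbf 1+Rp_u^t+Xq_u^t$. Write $x=[p^\top,q^\top]^\top\in\mathbb R^{2N}$, $x_i=(p_i,q_i)$, $d_i^t=(p_{u,i}^t,q_{u,i}^t)$. Let $\mathcal Y_i^t\subset\mathbb R^2$ be nonempty, compact and convex (for instance a box), $\mathcal Y^t=\prod_{i}\mathcal Y_i^t$, and let $[\cdot]_S$ be the Euclidean projection onto $S$. *Assumption 1.* The costs $f_i^t:\mathbb R^2\to\mathbb R$ are continuously differentiable and there are $m,\xi>0$ such that, with $\nabla f^t(x)=(\nabla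 f_i^t(x_i))_{i}$, for all $t$ and all $x,y\in\mathcal Y^t$, $$(\nabla f^t(x)-\nabla f^t(y))^\top(x-y)\ge m\|x-y\|_2^2,\qquad \|\nabla f^t(x)-\nabla f^t(y)\|_2\le\xi\|x-y\|_2 .$$ *Dynamics.* Let $u_{\varphi_i}(v_i,d_i)=[u_{\varphi_{p,i}}(v_i,p_{u,i}),\,u_{\varphi_{q,i}}(v_i,q_{u,i})]^\top\in\mathbb R^2$ be the local feedback policies, $u_\varphi(v,d)\in\mathbb R^{2N}$ the stacked vector of their values, and $\alpha>0$ the step size. With the exogenous data of slot $t$ held fixed, one update sends an operating point $(x,v)$ to $(x^+,v^+)$, where $$\hat v=\mathcal A x+v_{env}^t,\qquad x_i^+=\big[x_i-\alpha\big(\nabla f_i^t(x_i)+u_{\varphi_i}(\hat v_i,d_i^t)\big)\big]_{\mathcal Y_i^t}\ (i\in\mathcal N),\qquad v^+=\mathcal A x^++v_{env}^t .$$ An equilibrium in slot $t$ is an operating point that this update leaves unchanged. **Theorem 1.** Let Assumption 1 hold, and let $V\subseteq\mathbb R$ be a set that contains all the squared voltage magnitudes $(\mathcal A x+v_{env}^t)_i$,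 $x\in\mathcal Y^t$, $t\in\mathcal T$, $i\in\mathcal N$ (one may take $V=\mathbb R^+$ whenever these are positive). Suppose that for all $i\in\mathcal N$: (C1) $u_{\varphi_i}(v,d)=u_{\vartheta_i}(v)+u_{\phi_i}(d)$ for all $v\in V$, $d\in\mathbb R^2$; (C2) there is $L_{\vartheta_i}>0$ with $\|u_{\vartheta_i}(v)-u_{\vartheta_i}(v')\|_2\le L_{\vartheta_i}|v-v'|$ for all $v,v'\in V$. Then, for every $t\in\mathcal T$, the dynamics has an equilibrium, and every equilibrium $(x^\dagger,v^\dagger)$ satisfies $$x^\dagger=\big[x^\dagger-\alpha\big(\nabla f^t(x^\dagger)+u_\varphi(v^\dagger,d^t)\big)\big]_{\mathcal Y^t},\qquad v^\dagger=\mathcal A x^\dagger+v_{env}^t .$$ If moreover $\alpha<2m/\xi^2$ and (C3) $\displaystyle L_\vartheta:=\max_{i\in\mathcal N}L_{\vartheta_i}<\frac{1-\sqrt{1-2\alpha m+\alpha^2\xi^2}}{\alpha\|\mathcal A\|_2}$ (the bound being $+\infty$ if $\mathcal A=0$), then for every $t\in\mathcal T$ the equilibrium is unique. -/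

import Mathlib

open scoped Matrix.Norms.L2Operator

noncomputable section

namespace OPF

/-- A radial distribution network: a tree on the nodes `0, 1, …, N`, with root (substation) `0`
and with series resistance `r e` and series reactance `x e` on every line `e`.
The non-root nodes are indexed by `i : Fin N`, standing for the vertex `i.succ`. -/
structure Network (N : ℕ) where
  graph : SimpleGraph (Fin (N + 1))
  isTree : graph.IsTree
  r : Sym2 (Fin (N + 1)) → ℝ
  x : Sym2 (Fin (N + 1)) → ℝ

/-- Vectors `[pᵀ, qᵀ]ᵀ ∈ ℝ²ᴺ`: `Sum.inl i` is the active, `Sum.inr i` the reactive component. -/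
abbrev PQ (N : ℕ) : Type := EuclideanSpace ℝ (Fin N ⊕ Fin N)

/-- Pairs `(p_i, q_i)` at one node, with the Euclidean norm. -/
abbrev E2 : Type := EuclideanSpace ℝ (Fin 2)

/-- The pair `(p_i, q_i)` of a stacked vector `[pᵀ, qᵀ]ᵀ`. -/
def node {N : ℕ} (z : PQ N) (i : Fin N) : E2 := !₂[z (Sum.inl i), z (Sum.inr i)]

/-- The stacked vector `[pᵀ, qᵀ]ᵀ` with the prescribed pairs `(p_i, q_i)`. -/
def stack {N : ℕ} (w : Fin N → E2) : PQ N :=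
  WithLp.toLp 2 (Sum.elim (fun i => w i 0) (fun i => w i 1))

namespace Network

variable {N : ℕ} (G : Network N)

/-- The lines on the path from node `i` back to the root (the path is unique in a tree). -/
def pathToRoot (i : Fin N) : Set (Sym2 (Fin (N + 1))) :=
  {e | ∃ w : G.graph.Walk i.succ 0, w.IsPath ∧ e ∈ w.edges}

open Classical in
/-- The lines common to the paths of `i` and `j` back to the root. -/
def commonPath (i j : Fin N) : Finset (Sym2 (Fin (N + 1))) :=
  Finset.univ.filter fun e => e ∈ G.pathToRoot i ∧ e ∈ G.pathToRoot j

/-- `R_ij`, the sum of `2 r` over the common part of the two paths. -/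
def R : Matrix (Fin N) (Fin N) ℝ := Matrix.of fun i j => ∑ e ∈ G.commonPath i j, 2 * G.r e

/-- `X_ij`, the sum of `2 x` over the common part of the two paths. -/
def X : Matrix (Fin N) (Fin N) ℝ := Matrix.of fun i j => ∑ e ∈ G.commonPath i j, 2 * G.x e

/-- `𝒜 = [R, X]`. -/
def A : Matrix (Fin N) (Fin N ⊕ Fin N) ℝ := Matrix.fromCols G.R G.X

end Network

/-- The time-varying exogenous data: cost functions `f_i^t`, feasible sets `𝒴_i^t`, squared voltage
magnitude `v_0^t` of the root and uncontrollable injections `d^t = [p_uᵀ, q_uᵀ]ᵀ`. -/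
structure Exogenous (N : ℕ) (T : Type*) where
  f : T → Fin N → E2 → ℝ
  Y : T → Fin N → Set E2
  v0 : T → ℝ
  d : T → PQ N

/-- The local feedback policies `u_{φ_p,i}(v_i, p_{u,i})` and `u_{φ_q,i}(v_i, q_{u,i})`. -/
structure Policy (N : ℕ) where
  p : Fin N → ℝ → ℝ → ℝ
  q : Fin N → ℝ → ℝ → ℝ

/-- The pair `u_{φ_i}(v_i, d_i) = [u_{φ_p,i}(v_i, p_{u,i}), u_{φ_q,i}(v_i, q_{u,i})]ᵀ`. -/
def Policy.loc {N : ℕ} (u : Policy N) (i : Fin N) (v : ℝ) (d : E2) : E2 :=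
  !₂[u.p i v (d 0), u.q i v (d 1)]

/-- The vector `u_φ(v, d)`. -/
def Policy.vec {N : ℕ} (u : Policy N) (v : EuclideanSpace ℝ (Fin N)) (d : PQ N) : PQ N :=
  stack fun i => u.loc i (v i) (node d i)

/-- The Euclidean projection `[z]_S`: the point of `S` nearest to `z`. -/
def proj {E : Type*} [NormedAddCommGroup E] (S : Set E) (z : E) : E :=
  Classical.epsilon fun y => y ∈ S ∧ ∀ w ∈ S, ‖z - y‖ ≤ ‖z - w‖

/-- On a nonempty closed convex set the projection is characterized as the unique nearest point. -/
theorem eq_proj_iff {E : Type*} [NormedAddCommGroup E] [InnerProductSpace ℝ E] [CompleteSpace E]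
    {S : Set E} (hne : S.Nonempty) (hcl : IsClosed S) (hcv : Convex ℝ S) (z y : E) :
    y = proj S z ↔ y ∈ S ∧ ∀ w ∈ S, ‖z - y‖ ≤ ‖z - w‖ := by
  have key : ∀ a, (a ∈ S ∧ ∀ w ∈ S, ‖z - a‖ ≤ ‖z - w‖) → ‖z - a‖ = ⨅ w : S, ‖z - w‖ := by
    rintro a ⟨ha, h⟩
    have : Nonempty S := hne.to_subtype
    refine le_antisymm (le_ciInf fun w => h w w.2) ?_
    exact ciInf_le (f := fun w : S => ‖z - (w : E)‖)
      ⟨0, by rintro _ ⟨w, rfl⟩; exact norm_nonneg _⟩ ⟨a, ha⟩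
  have ex : ∃ a, a ∈ S ∧ ∀ w ∈ S, ‖z - a‖ ≤ ‖z - w‖ := by
    obtain ⟨a, ha, h⟩ := exists_norm_eq_iInf_of_complete_convex hne hcl.isComplete hcv z
    refine ⟨a, ha, fun w hw => h ▸ ?_⟩
    exact ciInf_le (f := fun w : S => ‖z - (w : E)‖)
      ⟨0, by rintro _ ⟨w, rfl⟩; exact norm_nonneg _⟩ ⟨w, hw⟩
  have hp : proj S z ∈ S ∧ ∀ w ∈ S, ‖z - proj S z‖ ≤ ‖z - w‖ := Classical.epsilon_spec ex
  refine ⟨fun h => h ▸ hp, fun h => ?_⟩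
  have h1 := (norm_eq_iInf_iff_real_inner_le_zero hcv h.1).1 (key y h) _ hp.1
  have h2 := (norm_eq_iInf_iff_real_inner_le_zero hcv hp.1).1 (key _ hp) _ h.1
  have e : inner ℝ (proj S z - y) (proj S z - y) =
      inner ℝ (z - y) (proj S z - y) + inner ℝ (z - proj S z) (y - proj S z) := by
    rw [← neg_sub (proj S z) y, inner_neg_right, ← sub_eq_add_neg, ← inner_sub_left]
    congr 1
    abel
  have h0 : inner ℝ (proj S z - y) (proj S z - y) = 0 :=
    le_antisymm (by linarith) real_inner_self_nonneg
  exact (sub_eq_zero.1 (inner_self_eq_zero.1 h0)).symm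

namespace Exogenous

variable {N : ℕ} {T : Type*} (D : Exogenous N T)

/-- `𝒴^t`, the product of the sets `𝒴_i^t`. -/
def feasible (t : T) : Set (PQ N) := {x | ∀ i, node x i ∈ D.Y t i}

/-- `∇f^t(x)`, the stacked vector of the local gradients `∇f_i^t(x_i)`. -/
def grad (t : T) (x : PQ N) : PQ N := stack fun i => gradient (D.f t i) (node x i)

/-- The uncontrollable component `v_env^t = v_0^t 𝟏 + R p_u^t + X q_u^t` of the voltages. -/
def venv (G : Network N) (t : T) : EuclideanSpace ℝ (Fin N) :=
  WithLp.toLp 2 fun i => D.v0 t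
    + G.R.mulVec (fun j => D.d t (Sum.inl j)) i + G.X.mulVec (fun j => D.d t (Sum.inr j)) i

/-- The linearized power flow `v^t(x) = 𝒜 x + v_env^t`. -/
def voltage (G : Network N) (t : T) (x : PQ N) : EuclideanSpace ℝ (Fin N) :=
  Matrix.toEuclideanLin G.A x + D.venv G t

/-- Every `f_i^t` is continuously differentiable, and `f^t` is `m`-strongly convex and `ξ`-smooth
on `𝒴^t`. -/
structure StronglyConvexSmooth (m ξ : ℝ) : Prop where
  contDiff : ∀ t i, ContDiff ℝ 1 (D.f t i)
  strong : ∀ t, ∀ x ∈ D.feasible t, ∀ y ∈ D.feasible t,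
    m * ‖x - y‖ ^ 2 ≤ inner ℝ (D.grad t x - D.grad t y) (x - y)
  smooth : ∀ t, ∀ x ∈ D.feasible t, ∀ y ∈ D.feasible t,
    ‖D.grad t x - D.grad t y‖ ≤ ξ * ‖x - y‖

end Exogenous

/-- An operating point `(x, v)` of the network. -/
abbrev OperatingPoint (N : ℕ) : Type := PQ N × EuclideanSpace ℝ (Fin N)

/-- One update of the local-feedback dynamics with the exogenous data of time slot `t`: each node
`i` measures `v̂_i`, the voltage that results from the current injections, performs the projected
step on its own pair `(p_i, q_i)`, and the new voltages are `𝒜 x + v_env^t`. -/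
def step {N : ℕ} {T : Type*} (G : Network N) (D : Exogenous N T) (u : Policy N) (α : ℝ) (t : T)
    (s : OperatingPoint N) : OperatingPoint N :=
  let vhat := D.voltage G t s.1
  let x' : PQ N := stack fun i => proj (D.Y t i)
    (node s.1 i - α • (gradient (D.f t i) (node s.1 i) + u.loc i (vhat i) (node (D.d t) i)))
  (x', D.voltage G t x')

/-- An equilibrium of the dynamics in time slot `t`: an operating point that the update with the
exogenous data of slot `t` leaves unchanged. -/
def IsEquilibrium {N : ℕ} {T : Type*} (G : Network N) (D : Exogenous N T) (u : Policy N) (α : ℝ)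
    (t : T) (s : OperatingPoint N) : Prop :=
  Function.IsFixedPt (step G D u α t) s

end OPF

end

/-! Distances in a product of local sets split over the nodes, so the nodewise projected step is one
projection onto the feasible set. The voltages are determined by `x`, so equilibria are the fixed
points of one projected map in `x` (`isEquilibrium_iff`). Existence needs only continuity on a
compact convex set, hence Brouwer. For uniqueness, compare two fixed points: the projection is
nonexpansive, the gradient step contracts by the square root (`norm_sub_smul_le`), and feedback adds
at most `α * ‖G.A‖` times the largest `L i`. C3 makes the sum of the two factors less than one.
Brouwer is reduced to the absence of a `C¹` retraction `r` onto a sphere, by the Milnor–Rogers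
volume argument. With `G = r - id`, the map `id + t G` permutes the ball for small `t > 0`, so the
integral of its Jacobian is the volume of the ball. The Jacobian is polynomial in `t`, so this
persists at `t = 1`, where the Jacobian of `r` vanishes. -/

namespace OPF

/-! ### Projection onto closed convex sets -/

section Projection

variable {E : Type*} [NormedAddCommGroup E] [InnerProductSpace ℝ E] [CompleteSpace E] {S : Set E}

theorem proj_mem (hne : S.Nonempty) (hcl : IsClosed S) (hcv : Convex ℝ S) (z : E) :
    proj S z ∈ S :=
  ((eq_proj_iff hne hcl hcv z _).1 rfl).1

theorem proj_eq_self (hne : S.Nonempty) (hcl : IsClosed S) (hcv : Convex ℝ S) {z : E}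
    (hz : z ∈ S) : proj S z = z :=
  ((eq_proj_iff hne hcl hcv z z).2 ⟨hz, fun w _ => by simp⟩).symm

theorem inner_sub_proj_nonpos (hne : S.Nonempty) (hcl : IsClosed S) (hcv : Convex ℝ S) (z : E)
    {w : E} (hw : w ∈ S) : inner ℝ (z - proj S z) (w - proj S z) ≤ 0 := by
  obtain ⟨hp, h⟩ := (eq_proj_iff hne hcl hcv z _).1 rfl
  refine (norm_eq_iInf_iff_real_inner_le_zero hcv hp).1 ?_ w hw
  have : Nonempty S := hne.to_subtype
  exact le_antisymm (le_ciInf fun w => h w w.2)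
    (ciInf_le (f := fun w : S => ‖z - (w : E)‖)
      ⟨0, by rintro _ ⟨w, rfl⟩; exact norm_nonneg _⟩ ⟨_, hp⟩)

/-- Adding the two obtuse-angle inequalities, each tested at the other projection, bounds the
squared left side by an inner product; Cauchy–Schwarz finishes. -/
theorem norm_proj_sub_proj_le (hne : S.Nonempty) (hcl : IsClosed S) (hcv : Convex ℝ S) (z w : E) :
    ‖proj S z - proj S w‖ ≤ ‖z - w‖ := by
  have h1 := inner_sub_proj_nonpos hne hcl hcv z (proj_mem hne hcl hcv w)
  have h2 := inner_sub_proj_nonpos hne hcl hcv w (proj_mem hne hcl hcv z)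
  have e : inner ℝ (proj S z - proj S w) (proj S z - proj S w) =
      inner ℝ (z - w) (proj S z - proj S w) + inner ℝ (z - proj S z) (proj S w - proj S z)
        + inner ℝ (w - proj S w) (proj S z - proj S w) := by
    rw [← neg_sub (proj S z) (proj S w), inner_neg_right, ← sub_eq_add_neg, ← inner_sub_left,
      ← inner_add_left]
    congr 1
    abel
  have h3 := real_inner_le_norm (z - w) (proj S z - proj S w)
  rw [real_inner_self_eq_norm_mul_norm] at e
  by_contra! h
  have : 0 < ‖proj S z - proj S w‖ := (norm_nonneg _).trans_lt h
  nlinarith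

theorem continuous_proj (hne : S.Nonempty) (hcl : IsClosed S) (hcv : Convex ℝ S) :
    Continuous (proj S) :=
  (LipschitzWith.of_dist_le_mul (K := 1) fun z w => by
    simpa [dist_eq_norm] using norm_proj_sub_proj_le hne hcl hcv z w).continuous

/-- The nearest point is the radial rescaling. Consequently a map vanishing on the sphere,
precomposed with this projection, vanishes outside the ball. -/
theorem norm_proj_closedBall {R : ℝ} (hR : 0 ≤ R) {x : E} (hx : R < ‖x‖) :
    ‖proj (Metric.closedBall (0 : E) R) x‖ = R := by
  have hx0 : 0 < ‖x‖ := hR.trans_lt hx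
  have hn : ‖(R / ‖x‖) • x‖ = R := by
    rw [norm_smul, Real.norm_of_nonneg (by positivity), div_mul_cancel₀ _ hx0.ne']
  rw [← (eq_proj_iff ⟨0, by simpa using hR⟩ Metric.isClosed_closedBall
    (convex_closedBall 0 R) x ((R / ‖x‖) • x)).2 ⟨by simp [hn], fun w hw => ?_⟩, hn]
  have hw' : ‖w‖ ≤ R := by simpa using hw
  have e : x - (R / ‖x‖) • x = (1 - R / ‖x‖) • x := by rw [sub_smul, one_smul]
  have h1 : R / ‖x‖ ≤ 1 := (div_le_one hx0).2 hx.le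
  rw [e, norm_smul, Real.norm_of_nonneg (by linarith), sub_mul, div_mul_cancel₀ _ hx0.ne']
  have := norm_sub_norm_le x w
  linarith

end Projection

/-! ### Brouwer's fixed point theorem -/

section Brouwer

open MeasureTheory Polynomial

/-- Lagrange extrapolation. The weights do not depend on `P`, so the same ones serve at every point
of an integral. -/
theorem exists_weights_eval_one {n : ℕ} {v : Fin (n + 1) → ℝ} (hv : Function.Injective v) :
    ∃ w : Fin (n + 1) → ℝ, ∀ P : ℝ[X], P.natDegree ≤ n →
      P.eval 1 = ∑ j, w j * P.eval (v j) := by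
  refine ⟨fun j => (Lagrange.basis Finset.univ v j).eval 1, fun P hP => ?_⟩
  have h := Lagrange.eq_interpolate (s := Finset.univ) hv.injOn (f := P) (by
    refine (degree_le_of_natDegree_le hP).trans_lt ?_
    rw [Finset.card_univ, Fintype.card_fin]
    exact_mod_cast Nat.lt_succ_self n)
  conv_lhs => rw [h]
  simp [Lagrange.interpolate_apply, eval_finsetSum, mul_comm]

variable {E : Type*} [NormedAddCommGroup E]

theorem exists_polynomial_eval_eq_det [NormedSpace ℝ E] [FiniteDimensional ℝ E]
    (A : E →L[ℝ] E) : ∃ P : ℝ[X], P.natDegree ≤ Module.finrank ℝ E ∧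
      ∀ t : ℝ, P.eval t = (ContinuousLinearMap.id ℝ E + t • A).det := by
  let b := Module.finBasis ℝ E
  let M := LinearMap.toMatrix b b (A : E →ₗ[ℝ] E)
  refine ⟨((X : ℝ[X]) • M.map C + (1 : Matrix _ _ ℝ).map C).det, ?_, fun t => ?_⟩
  · simpa using natDegree_det_X_add_C_le M 1
  · rw [ContinuousLinearMap.det, ← LinearMap.det_toMatrix b, ← coe_evalRingHom,
      RingHom.map_det]
    congr 1
    ext i j
    simp [M, Matrix.one_apply, LinearMap.toMatrix_apply, add_comm, apply_ite, Finsupp.single_apply,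
      eq_comm]
    exact mul_comm _ _

/-- Along the segment from `0` to `A` the determinant never vanishes, since a kernel vector would
satisfy `‖x‖ ≤ ‖A‖ * ‖x‖`. It equals one at the start, so it stays positive. -/
theorem det_id_add_pos [NormedSpace ℝ E] [FiniteDimensional ℝ E]
    {A : E →L[ℝ] E} (hA : ‖A‖ < 1) : 0 < (ContinuousLinearMap.id ℝ E + A).det := by
  have hcont : Continuous fun t : ℝ => (ContinuousLinearMap.id ℝ E + t • A).det :=
    ContinuousLinearMap.continuous_det.comp (by fun_prop)
  have hne : ∀ t ∈ Set.Icc (0 : ℝ) 1, (ContinuousLinearMap.id ℝ E + t • A).det ≠ 0 := by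
    intro t ht h0
    obtain ⟨x, hx, hx0⟩ := (Submodule.ne_bot_iff _).1 (LinearMap.bot_lt_ker_of_det_eq_zero h0).ne'
    have h : x = -(t • A x) := eq_neg_of_add_eq_zero_left (by simpa using hx)
    have h1 : ‖x‖ ≤ ‖A‖ * ‖x‖ := by
      calc ‖x‖ = t * ‖A x‖ := by
            conv_lhs => rw [h]
            rw [norm_neg, norm_smul, Real.norm_of_nonneg ht.1]
        _ ≤ 1 * ‖A x‖ := by gcongr; exact ht.2
        _ ≤ ‖A‖ * ‖x‖ := by rw [one_mul]; exact A.le_opNorm x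
    nlinarith [norm_pos_iff.2 hx0]
  by_contra! h
  have h0 : (ContinuousLinearMap.id ℝ E + (0 : ℝ) • A).det = 1 := by
    simp [ContinuousLinearMap.det]
  obtain ⟨t, ht, hd⟩ := intermediate_value_Icc' zero_le_one hcont.continuousOn
    (show (0 : ℝ) ∈ Set.Icc _ _ from ⟨by simpa using h, by rw [h0]; exact zero_le_one⟩)
  exact hne t ht hd

variable [InnerProductSpace ℝ E] [FiniteDimensional ℝ E]

/-- A Lipschitz perturbation of the identity that vanishes on the sphere permutes the ball. -/
theorem bijOn_closedBall_of_lipschitzOn {R : ℝ} (hR : 0 ≤ R) {G : E → E} {K : ℝ}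
    (hK0 : 0 ≤ K) (hK : K < 1)
    (hG : ∀ x ∈ Metric.closedBall (0 : E) R, ∀ y ∈ Metric.closedBall (0 : E) R,
      ‖G x - G y‖ ≤ K * ‖x - y‖)
    (hG0 : ∀ x, ‖x‖ = R → G x = 0) :
    Set.BijOn (fun x => x + G x) (Metric.closedBall (0 : E) R) (Metric.closedBall (0 : E) R) := by
  have hne : (Metric.closedBall (0 : E) R).Nonempty := ⟨0, by simpa using hR⟩
  have hcl : IsClosed (Metric.closedBall (0 : E) R) := Metric.isClosed_closedBall
  have hcv := convex_closedBall (0 : E) R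
  set π : E → E := proj (Metric.closedBall (0 : E) R) with hπ
  -- Extending `G` through the projection gives a Lipschitz perturbation of the identity on all of
  -- `E`, hence a global bijection, equal to the identity off the ball.
  set F : E → E := fun x => x + G (π x) with hF
  have happ : ApproximatesLinearOn F (ContinuousLinearEquiv.refl ℝ E : E →L[ℝ] E) Set.univ
      ⟨K, hK0⟩ := by
    intro x _ y _
    calc ‖F x - F y - (ContinuousLinearEquiv.refl ℝ E : E →L[ℝ] E) (x - y)‖
        = ‖G (π x) - G (π y)‖ := by congr 1; simp [hF]; abel
      _ ≤ K * ‖π x - π y‖ := hG _ (proj_mem hne hcl hcv x) _ (proj_mem hne hcl hcv y)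
      _ ≤ K * ‖x - y‖ := by gcongr; exact norm_proj_sub_proj_le hne hcl hcv x y
  have hc : Subsingleton E ∨
      (⟨K, hK0⟩ : NNReal) < ‖((ContinuousLinearEquiv.refl ℝ E).symm : E →L[ℝ] E)‖₊⁻¹ := by
    rcases subsingleton_or_nontrivial E with h | h
    · exact .inl h
    · right
      have : ‖((ContinuousLinearEquiv.refl ℝ E).symm : E →L[ℝ] E)‖₊ = 1 :=
        ContinuousLinearMap.nnnorm_id
      rw [this, inv_one]
      exact hK
  have hinj : Function.Injective F := Set.injOn_univ.1 (happ.injOn hc)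
  have hsurj : Function.Surjective F := happ.surjective hc
  have hin : ∀ x ∈ Metric.closedBall (0 : E) R, F x = x + G x := fun x hx => by
    simp only [hF, hπ, proj_eq_self hne hcl hcv hx]
  have hout : ∀ x ∉ Metric.closedBall (0 : E) R, F x = x := fun x hx => by
    have : R < ‖x‖ := by simpa using hx
    simp only [hF, hπ, hG0 _ (norm_proj_closedBall hR this), add_zero]
  refine Set.BijOn.congr (f₁ := F) ⟨?_, hinj.injOn, ?_⟩ hin
  · intro x hx
    -- If `F x` left the ball, `F` would fix `F x`, and injectivity would give `F x = x`.
    by_contra h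
    exact h (by rwa [hinj (hout _ h)])
  · intro y hy
    obtain ⟨x, rfl⟩ := hsurj y
    by_cases hx : x ∈ Metric.closedBall (0 : E) R
    · exact ⟨x, hx, rfl⟩
    · rw [hout x hx] at hy
      exact absurd hy hx

/-- There is no `C¹` retraction onto a sphere. -/
theorem not_contDiff_retraction_sphere {R : ℝ} (hR : 0 < R) {r : E → E} (hr : ContDiff ℝ 1 r)
    (hnorm : ∀ x, ‖r x‖ = R) (hid : ∀ x, ‖x‖ = R → r x = x) : False := by
  borelize E
  let B := Metric.closedBall (0 : E) R
  have hB : IsCompact B := isCompact_closedBall 0 R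
  let G : E → E := fun x => r x - x
  have hG : ContDiff ℝ 1 G := hr.sub contDiff_id
  have hGc : Continuous (fderiv ℝ G) := hG.continuous_fderiv one_ne_zero
  have hGd : Differentiable ℝ G := hG.differentiable one_ne_zero
  obtain ⟨C, hC⟩ := hB.exists_bound_of_continuousOn hGc.continuousOn
  let D : ℝ := max C 0
  have hD : ∀ x ∈ B, ‖fderiv ℝ G x‖ ≤ D := fun x hx => (hC x hx).trans (le_max_left _ _)
  have hD0 : 0 ≤ D := le_max_right _ _
  have hlip : ∀ x ∈ B, ∀ y ∈ B, ‖G x - G y‖ ≤ D * ‖x - y‖ := fun x hx y hy =>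
    (convex_closedBall (0 : E) R).norm_image_sub_le_of_norm_fderiv_le
      (fun z _ => hGd z) hD hy hx
  let n := Module.finrank ℝ E
  -- Distinct nodes, small enough that `v j * D < 1`; `D + 1` guards against `D = 0`.
  let v : Fin (n + 1) → ℝ := fun j => 1 / ((D + 1) * ((j : ℝ) + 1))
  have hvpos : ∀ j, 0 < v j := fun j => by positivity
  have hvD : ∀ j, v j * D < 1 := fun j => by
    rw [div_mul_eq_mul_div, one_mul, div_lt_one (by positivity)]
    nlinarith [(Nat.cast_nonneg (j : ℕ) : (0 : ℝ) ≤ _)]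
  have hvinj : Function.Injective v := fun i j h => by
    simp only [v, one_div, inv_inj] at h
    have := mul_left_cancel₀ (by positivity) h
    exact Fin.ext (by exact_mod_cast add_right_cancel this)
  obtain ⟨w, hw⟩ := exists_weights_eval_one hvinj
  have hsum : ∑ j, w j = 1 := by simpa using (hw 1 (by simp)).symm
  let μ : Measure E := Measure.addHaar
  let J : ℝ → E → ℝ := fun t x => (ContinuousLinearMap.id ℝ E + t • fderiv ℝ G x).det
  have hJc : ∀ t, Continuous (J t) := fun t =>
    ContinuousLinearMap.continuous_det.comp (by fun_prop)
  have hvol : ∀ j, ∫ x in B, J (v j) x ∂μ = μ.real B := by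
    intro j
    have hbij := bijOn_closedBall_of_lipschitzOn hR.le (G := fun x => v j • G x)
      (K := v j * D) (mul_nonneg (hvpos j).le hD0) (hvD j)
      (fun x hx y hy => by
        rw [← smul_sub, norm_smul, Real.norm_of_nonneg (hvpos j).le, mul_assoc]
        exact mul_le_mul_of_nonneg_left (hlip x hx y hy) (hvpos j).le)
      (fun x hx => by simp [G, hid x hx])
    have hder : ∀ x ∈ B, HasFDerivWithinAt (fun x => x + v j • G x)
        (ContinuousLinearMap.id ℝ E + v j • fderiv ℝ G x) B x := fun x _ =>
      ((hasFDerivAt_id x).add ((hGd x).hasFDerivAt.const_smul (v j))).hasFDerivWithinAt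
    have h := integral_image_eq_integral_abs_det_fderiv_smul μ hB.measurableSet hder hbij.injOn
      (fun _ => (1 : ℝ))
    rw [hbij.image_eq] at h
    simp only [integral_const, smul_eq_mul, mul_one, measureReal_restrict_apply_univ] at h
    rw [h]
    refine setIntegral_congr_fun hB.measurableSet fun x hx => (abs_of_pos ?_).symm
    refine det_id_add_pos (lt_of_le_of_lt ?_ (hvD j))
    rw [norm_smul, Real.norm_of_nonneg (hvpos j).le]
    exact mul_le_mul_of_nonneg_left (hD x hx) (hvpos j).le
  have hone : ∀ x, J 1 x = 0 := by
    intro x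
    have hrd : HasFDerivAt r (fderiv ℝ r x) x := (hr.differentiable one_ne_zero x).hasFDerivAt
    have e : ContinuousLinearMap.id ℝ E + (1 : ℝ) • fderiv ℝ G x = fderiv ℝ r x := by
      have : fderiv ℝ G x = fderiv ℝ r x - ContinuousLinearMap.id ℝ E :=
        (hrd.sub (hasFDerivAt_id x)).fderiv
      rw [this]; simp
    -- Differentiating the constant `‖r‖ ^ 2` shows that `r x` is orthogonal to the range of the
    -- derivative, which therefore cannot be surjective.
    have horth : ∀ y, inner ℝ (r x) (fderiv ℝ r x y) = 0 := by
      intro y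
      have h1 := (hrd.norm_sq).unique (by
        simp only [hnorm]; exact hasFDerivAt_const (R ^ 2) x)
      have := congrArg (fun T : E →L[ℝ] ℝ => T y) h1
      simpa using this
    simp only [J, e]
    by_contra hdet
    have hs : Function.Surjective (fderiv ℝ r x) := by
      exact (LinearMap.equivOfDetNeZero _ hdet).surjective
    obtain ⟨y, hy⟩ := hs (r x)
    have h0 := horth y
    rw [hy, real_inner_self_eq_norm_sq, hnorm] at h0
    exact hR.ne' (by simpa using h0)
  have hsumJ : ∀ x, ∑ j, w j * J (v j) x = 0 := by
    intro x
    obtain ⟨P, hP, hPe⟩ := exists_polynomial_eval_eq_det (fderiv ℝ G x)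
    have := hw P hP
    simp only [hPe] at this
    exact this.symm.trans (hone x)
  have hzero : μ.real B = 0 := by
    calc μ.real B = ∑ j, w j * μ.real B := by rw [← Finset.sum_mul, hsum, one_mul]
      _ = ∑ j, ∫ x in B, w j * J (v j) x ∂μ := by
          simp only [integral_const_mul, hvol]
      _ = ∫ x in B, ∑ j, w j * J (v j) x ∂μ :=
          (integral_finsetSum _ fun j _ =>
            ((hJc (v j)).continuousOn.integrableOn_compact hB).const_mul _).symm
      _ = 0 := by simp [hsumJ]
  have hpos : 0 < μ.real B :=
    ENNReal.toReal_pos (Metric.measure_closedBall_pos μ 0 hR).ne' hB.measure_lt_top.ne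
  exact hpos.ne' hzero

/-- **Brouwer's fixed point theorem** for bounded continuous self-maps of a Euclidean space. -/
theorem exists_isFixedPt_of_continuous_of_bounded {g : E → E} (hg : Continuous g) {R : ℝ}
    (hb : ∀ x, ‖g x‖ ≤ R) : ∃ x, Function.IsFixedPt g x := by
  by_contra! hfix
  have hR : 0 ≤ R := (norm_nonneg _).trans (hb 0)
  let S : ℝ := R + 1
  have hS : 0 < S := by positivity
  have hpos : ∀ x, 0 < ‖x - g x‖ := fun x => by
    rw [norm_pos_iff, sub_ne_zero]
    exact fun h => hfix x h.symm
  -- In the tolerance, `1` keeps `k` bounded by `S`, and `‖x - g x‖` keeps it free of fixed points.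
  obtain ⟨k, hk, hkg, -⟩ := hg.exists_contDiff_approx 1 (ε := fun x => min 1 ‖x - g x‖)
    (by fun_prop) fun x => lt_min one_pos (hpos x)
  have hkS : ∀ x, ‖k x‖ < S := fun x => by
    have h1 := (hkg x).trans_le (min_le_left _ _)
    rw [dist_eq_norm] at h1
    have := norm_sub_norm_le (k x) (g x)
    have := hb x
    simp only [S]
    linarith
  have hkfix : ∀ x, x - k x ≠ 0 := fun x h => by
    have h1 := (hkg x).trans_le (min_le_right _ _)
    rw [← sub_eq_zero.1 h, dist_eq_norm] at h1
    exact lt_irrefl _ h1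
  -- The cutoff makes `h` the identity on the sphere of radius `2 * S`. In the ball of radius `S`,
  -- `h` is nonzero as `k` has no fixed point; outside, because `‖k x‖ < S < ‖x‖`. Normalizing `h`
  -- gives the forbidden retraction.
  let χ : ContDiffBump (0 : E) := ⟨S, 2 * S, hS, by linarith⟩
  let h : E → E := fun x => x - χ x • k x
  have hh : ContDiff ℝ 1 h := contDiff_id.sub (χ.contDiff.smul hk)
  have hh0 : ∀ x, h x ≠ 0 := by
    intro x hx
    by_cases hxS : x ∈ Metric.closedBall (0 : E) S
    · refine hkfix x ?_
      simpa [h, χ.one_of_mem_closedBall hxS] using hx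
    · have hx1 : S < ‖x‖ := by simpa using hxS
      have hx2 : x = χ x • k x := sub_eq_zero.1 hx
      have : ‖x‖ ≤ 1 * ‖k x‖ := by
        conv_lhs => rw [hx2]
        rw [norm_smul, Real.norm_of_nonneg χ.nonneg]
        exact mul_le_mul_of_nonneg_right χ.le_one (norm_nonneg _)
      linarith [hkS x]
  refine not_contDiff_retraction_sphere (R := 2 * S) (by positivity)
    (r := fun x => (2 * S / ‖h x‖) • h x) ?_ (fun x => ?_) fun x hx => ?_
  · exact (contDiff_const.div (hh.norm ℝ hh0) fun x => norm_ne_zero_iff.2 (hh0 x)).smul hh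
  · rw [norm_smul, Real.norm_of_nonneg (by positivity),
      div_mul_cancel₀ _ (norm_ne_zero_iff.2 (hh0 x))]
  · have : h x = x := by
      have : χ x = 0 := χ.zero_of_le_dist (by simp [hx, χ])
      simp [h, this]
    simp only [this, hx]
    rw [div_self (by positivity), one_smul]

end Brouwer

/-! ### Nodewise decomposition of stacked vectors -/

section Stacking

variable {N : ℕ}

@[simp] theorem node_stack (w : Fin N → E2) (i : Fin N) : node (stack w) i = w i := by
  ext j; fin_cases j <;> simp [node, stack]

@[simp] theorem stack_node (z : PQ N) : stack (node z) = z := by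
  ext j; rcases j with j | j <;> simp [node, stack]

theorem node_add (y z : PQ N) (i : Fin N) : node (y + z) i = node y i + node z i := by
  ext j; fin_cases j <;> simp [node]

theorem node_sub (y z : PQ N) (i : Fin N) : node (y - z) i = node y i - node z i := by
  ext j; fin_cases j <;> simp [node]

theorem node_smul (c : ℝ) (z : PQ N) (i : Fin N) : node (c • z) i = c • node z i := by
  ext j; fin_cases j <;> simp [node]

theorem norm_sq_eq_sum_node (z : PQ N) : ‖z‖ ^ 2 = ∑ i, ‖node z i‖ ^ 2 := by
  simp [EuclideanSpace.norm_sq_eq, node, Fintype.sum_sum_type, Finset.sum_add_distrib]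

theorem continuous_node (i : Fin N) : Continuous fun z : PQ N => node z i := by
  refine (PiLp.continuous_toLp 2 _).comp (continuous_pi fun j => ?_)
  fin_cases j
  · exact (EuclideanSpace.proj (𝕜 := ℝ) (Sum.inl i : Fin N ⊕ Fin N)).continuous
  · exact (EuclideanSpace.proj (𝕜 := ℝ) (Sum.inr i : Fin N ⊕ Fin N)).continuous

theorem continuous_stack : Continuous (stack : (Fin N → E2) → PQ N) := by
  refine (PiLp.continuous_toLp 2 _).comp (continuous_pi fun j => ?_)
  rcases j with j | j
  · exact (EuclideanSpace.proj (𝕜 := ℝ) (0 : Fin 2)).continuous.comp (continuous_apply j)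
  · exact (EuclideanSpace.proj (𝕜 := ℝ) (1 : Fin 2)).continuous.comp (continuous_apply j)

theorem norm_stack_sub_stack_le {w w' : Fin N → E2} {K : ℝ} (hK : 0 ≤ K)
    {v v' : EuclideanSpace ℝ (Fin N)} (h : ∀ i, ‖w i - w' i‖ ≤ K * ‖v i - v' i‖) :
    ‖stack w - stack w'‖ ≤ K * ‖v - v'‖ := by
  refine le_of_sq_le_sq ?_ (by positivity)
  rw [norm_sq_eq_sum_node, mul_pow, EuclideanSpace.norm_sq_eq, Finset.mul_sum]
  refine Finset.sum_le_sum fun i _ => ?_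
  rw [node_sub, node_stack, node_stack, ← mul_pow, PiLp.sub_apply]
  exact pow_le_pow_left₀ (norm_nonneg _) (h i) 2

end Stacking

/-! ### The feasible set, the gradient map and the voltage map -/

namespace Exogenous

variable {N : ℕ} {T : Type*} (D : Exogenous N T) (t : T)

theorem feasible_nonempty (hne : ∀ i, (D.Y t i).Nonempty) : (D.feasible t).Nonempty := by
  choose w hw using hne
  exact ⟨stack w, fun i => by simpa using hw i⟩

theorem isClosed_feasible (hcl : ∀ i, IsClosed (D.Y t i)) : IsClosed (D.feasible t) := by
  rw [feasible, Set.ofPred_forall]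
  exact isClosed_iInter fun i => (hcl i).preimage (continuous_node i)

theorem isCompact_feasible (hc : ∀ i, IsCompact (D.Y t i)) : IsCompact (D.feasible t) := by
  have : D.feasible t = stack '' Set.univ.pi (D.Y t) := by
    ext z
    refine ⟨fun hz => ⟨node z, fun i _ => hz i, stack_node z⟩, ?_⟩
    rintro ⟨w, hw, rfl⟩ i
    simpa using hw i trivial
  rw [this]
  exact (isCompact_univ_pi hc).image continuous_stack

theorem convex_feasible (hcv : ∀ i, Convex ℝ (D.Y t i)) : Convex ℝ (D.feasible t) := by
  intro x hx y hy a b ha hb hab i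
  rw [node_add, node_smul, node_smul]
  exact hcv i (hx i) (hy i) ha hb hab

/-- The squared distance is a sum over nodes, minimized term by term. -/
theorem stack_proj_eq_proj_feasible (hne : ∀ i, (D.Y t i).Nonempty)
    (hcl : ∀ i, IsClosed (D.Y t i)) (hcv : ∀ i, Convex ℝ (D.Y t i)) (z : PQ N) :
    stack (fun i => proj (D.Y t i) (node z i)) = proj (D.feasible t) z := by
  refine (eq_proj_iff (D.feasible_nonempty t hne) (D.isClosed_feasible t hcl)
    (D.convex_feasible t hcv) z _).2 ⟨fun i => ?_, fun w hw => ?_⟩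
  · simpa using proj_mem (hne i) (hcl i) (hcv i) _
  · refine le_of_sq_le_sq ?_ (norm_nonneg _)
    rw [norm_sq_eq_sum_node, norm_sq_eq_sum_node]
    refine Finset.sum_le_sum fun i _ => pow_le_pow_left₀ (norm_nonneg _) ?_ 2
    rw [node_sub, node_sub, node_stack]
    exact ((eq_proj_iff (hne i) (hcl i) (hcv i) _ _).1 rfl).2 _ (hw i)

theorem continuous_grad (hf : ∀ i, ContDiff ℝ 1 (D.f t i)) : Continuous (D.grad t) := by
  refine continuous_stack.comp (continuous_pi fun i => ?_)
  exact ((InnerProductSpace.toDual ℝ E2).symm.continuous.comp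
    ((hf i).continuous_fderiv one_ne_zero)).comp (continuous_node i)

theorem norm_voltage_sub_voltage_le (G : Network N) (x y : PQ N) :
    ‖D.voltage G t x - D.voltage G t y‖ ≤ ‖G.A‖ * ‖x - y‖ := by
  rw [voltage, voltage, add_sub_add_right_eq_sub, ← map_sub]
  exact G.A.l2_opNorm_mulVec (x - y)

end Exogenous

/-! ### Equilibria as fixed points, and their existence -/

section Dynamics

variable {N : ℕ} {T : Type*} {G : Network N} {D : Exogenous N T} {u : Policy N} {α : ℝ} {t : T}

theorem step_fst (hne : ∀ i, (D.Y t i).Nonempty) (hcl : ∀ i, IsClosed (D.Y t i))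
    (hcv : ∀ i, Convex ℝ (D.Y t i)) (s : OperatingPoint N) :
    (step G D u α t s).1 = proj (D.feasible t)
      (s.1 - α • (D.grad t s.1 + u.vec (D.voltage G t s.1) (D.d t))) := by
  rw [← D.stack_proj_eq_proj_feasible t hne hcl hcv]
  simp only [step, node_sub, node_smul, node_add, Exogenous.grad, Policy.vec, node_stack]

/-- Equilibria are the solutions of the projected fixed-point equation, with the voltages given by
the power flow. -/
theorem isEquilibrium_iff (hne : ∀ i, (D.Y t i).Nonempty) (hcl : ∀ i, IsClosed (D.Y t i))
    (hcv : ∀ i, Convex ℝ (D.Y t i)) (s : OperatingPoint N) :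
    IsEquilibrium G D u α t s ↔
      s.1 = proj (D.feasible t)
        (s.1 - α • (D.grad t s.1 + u.vec (D.voltage G t s.1) (D.d t))) ∧
      s.2 = D.voltage G t s.1 := by
  have h2 : (step G D u α t s).2 = D.voltage G t (step G D u α t s).1 := rfl
  rw [IsEquilibrium, Function.IsFixedPt, Prod.ext_iff, h2, step_fst hne hcl hcv]
  constructor
  · rintro ⟨h, h'⟩
    rw [h] at h'
    exact ⟨h.symm, h'.symm⟩
  · rintro ⟨h, h'⟩
    rw [← h]
    exact ⟨rfl, h'.symm⟩

theorem exists_isEquilibrium (hne : ∀ i, (D.Y t i).Nonempty)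
    (hcompact : ∀ i, IsCompact (D.Y t i)) (hcv : ∀ i, Convex ℝ (D.Y t i))
    (hf : ∀ i, ContDiff ℝ 1 (D.f t i))
    (hu : ContinuousOn (fun x => u.vec (D.voltage G t x) (D.d t)) (D.feasible t)) :
    ∃ s, IsEquilibrium G D u α t s := by
  have hcl := fun i => (hcompact i).isClosed
  have hne' := D.feasible_nonempty t hne
  have hcl' := D.isClosed_feasible t hcl
  have hcv' := D.convex_feasible t hcv
  let P := proj (D.feasible t)
  have hP : Continuous P := continuous_proj hne' hcl' hcv'
  have hPm : ∀ z, P z ∈ D.feasible t := proj_mem hne' hcl' hcv'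
  -- Precomposing with `P` makes the map continuous on the whole space, though the policy is
  -- controlled only at feasible points. A fixed point is feasible, so there `P` drops out.
  let g : PQ N → PQ N := fun z =>
    P (P z - α • (D.grad t (P z) + u.vec (D.voltage G t (P z)) (D.d t)))
  have hg : Continuous g := hP.comp (hP.sub ((((D.continuous_grad t hf).comp hP).add
    (hu.comp_continuous hP hPm)).const_smul α))
  obtain ⟨R, hR⟩ := (D.isCompact_feasible t hcompact).isBounded.exists_norm_le
  obtain ⟨x, hx⟩ := exists_isFixedPt_of_continuous_of_bounded hg fun z => hR _ (hPm _)
  have hxP : P x = x := proj_eq_self hne' hcl' hcv' (by rw [← hx.eq]; exact hPm _)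
  refine ⟨(x, D.voltage G t x), (isEquilibrium_iff hne hcl hcv _).2 ⟨?_, rfl⟩⟩
  have := hx.eq
  simp only [g, hxP] at this
  exact this.symm

end Dynamics

/-- A gradient step on a strongly monotone Lipschitz map contracts. -/
theorem norm_sub_smul_le {E : Type*} [NormedAddCommGroup E] [InnerProductSpace ℝ E] {x g : E}
    {α m ξ : ℝ} (hα : 0 ≤ α) (hm : m * ‖x‖ ^ 2 ≤ inner ℝ g x) (hξ : ‖g‖ ≤ ξ * ‖x‖)
    (hx : x ≠ 0) :
    ‖x - α • g‖ ≤ √(1 - 2 * α * m + α ^ 2 * ξ ^ 2) * ‖x‖ := by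
  have hx0 : 0 < ‖x‖ := norm_pos_iff.2 hx
  have hg : ‖g‖ ^ 2 ≤ ξ ^ 2 * ‖x‖ ^ 2 := by
    rw [← mul_pow]; exact pow_le_pow_left₀ (norm_nonneg _) hξ 2
  have h : ‖x - α • g‖ ^ 2 ≤ (1 - 2 * α * m + α ^ 2 * ξ ^ 2) * ‖x‖ ^ 2 := by
    rw [norm_sub_sq_real, inner_smul_right, norm_smul, mul_pow, real_inner_comm,
      Real.norm_of_nonneg hα]
    nlinarith [mul_le_mul_of_nonneg_left hm hα, mul_le_mul_of_nonneg_left hg (sq_nonneg α)]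
  calc ‖x - α • g‖ = √(‖x - α • g‖ ^ 2) := (Real.sqrt_sq (norm_nonneg _)).symm
    _ ≤ √((1 - 2 * α * m + α ^ 2 * ξ ^ 2) * ‖x‖ ^ 2) := Real.sqrt_le_sqrt h
    _ = _ := by rw [Real.sqrt_mul' _ (sq_nonneg _), Real.sqrt_sq hx0.le]

end OPF

/-! ### Existence, characterization and uniqueness of equilibria -/

theorem theorem1 {N : ℕ} {T : Type*} (G : OPF.Network N) (D : OPF.Exogenous N T)
    (u : OPF.Policy N) (α m ξ : ℝ) (hα : 0 < α) (hm : 0 < m) (hξ : 0 < ξ)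
    -- the feasible sets are nonempty, compact and convex
    (hne : ∀ t i, (D.Y t i).Nonempty)
    (hcompact : ∀ t i, IsCompact (D.Y t i))
    (hconvex : ∀ t i, Convex ℝ (D.Y t i))
    -- the costs are continuously differentiable, `m`-strongly convex and `ξ`-smooth
    (hf : D.StronglyConvexSmooth m ξ)
    -- the range `V` of voltages on which the policies are considered (usually the positive reals)
    (V : Set ℝ) (hV : ∀ t, ∀ x ∈ D.feasible t, ∀ i, D.voltage G t x i ∈ V)
    -- C1: the policies are separable
    (uθ : Fin N → ℝ → OPF.E2) (uφ : Fin N → OPF.E2 → OPF.E2)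
    (hC1 : ∀ i, ∀ v ∈ V, ∀ d, u.loc i v d = uθ i v + uφ i d)
    -- C2: the voltage-dependent parts are Lipschitz continuous
    (L : Fin N → ℝ) (hL : ∀ i, 0 < L i)
    (hC2 : ∀ i, ∀ v ∈ V, ∀ v' ∈ V, ‖uθ i v - uθ i v'‖ ≤ L i * ‖v - v'‖) :
    ∀ t,
      -- an equilibrium exists
      (∃ s, OPF.IsEquilibrium G D u α t s) ∧
      -- every equilibrium satisfies the equilibrium equations
      (∀ s : OPF.OperatingPoint N, OPF.IsEquilibrium G D u α t s →
        s.1 = OPF.proj (D.feasible t) (s.1 - α • (D.grad t s.1 + u.vec s.2 (D.d t))) ∧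
        s.2 = Matrix.toEuclideanLin G.A s.1 + D.venv G t) ∧
      -- under C3, written without division by `‖𝒜‖₂`, the equilibrium is unique
      (α < 2 * m / ξ ^ 2 →
        (⨆ i, L i) * (α * ‖G.A‖) < 1 - √(1 - 2 * α * m + α ^ 2 * ξ ^ 2) →
        ∃! s, OPF.IsEquilibrium G D u α t s) := by
  intro t
  have hcl := fun i => (hcompact t i).isClosed
  have hne' := D.feasible_nonempty t (hne t)
  have hcl' := D.isClosed_feasible t hcl
  have hcv' := D.convex_feasible t (hconvex t)
  have hiff := OPF.isEquilibrium_iff (G := G) (u := u) (α := α) (hne t) hcl (hconvex t)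
  have hvec : ∀ x ∈ D.feasible t, u.vec (D.voltage G t x) (D.d t) =
      OPF.stack fun i => uθ i (D.voltage G t x i) + uφ i (OPF.node (D.d t) i) := fun x hx => by
    simp only [OPF.Policy.vec, hC1 _ _ (hV t x hx _)]
  have hLs : ∀ i, L i ≤ ⨆ i, L i := le_ciSup (Set.finite_range L).bddAbove
  have hLs0 : 0 ≤ ⨆ i, L i := Real.iSup_nonneg fun i => (hL i).le
  have hlip : ∀ x ∈ D.feasible t, ∀ y ∈ D.feasible t,
      ‖u.vec (D.voltage G t x) (D.d t) - u.vec (D.voltage G t y) (D.d t)‖ ≤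
        (⨆ i, L i) * (‖G.A‖ * ‖x - y‖) := fun x hx y hy => by
    rw [hvec x hx, hvec y hy]
    refine (OPF.norm_stack_sub_stack_le hLs0 (v := D.voltage G t x) (v' := D.voltage G t y)
      fun i => ?_).trans
      (mul_le_mul_of_nonneg_left (D.norm_voltage_sub_voltage_le t G x y) hLs0)
    -- By separability the injection-dependent parts cancel, leaving only the Lipschitz voltage
    -- terms.
    rw [add_sub_add_right_eq_sub]
    exact (hC2 i _ (hV t x hx i) _ (hV t y hy i)).trans
      (mul_le_mul_of_nonneg_right (hLs i) (norm_nonneg _))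
  have hcont : ContinuousOn (fun x => u.vec (D.voltage G t x) (D.d t)) (D.feasible t) :=
    (LipschitzOnWith.of_dist_le_mul (K := ⟨(⨆ i, L i) * ‖G.A‖, by positivity⟩)
      fun x hx y hy => by
        rw [dist_eq_norm, dist_eq_norm]
        exact (hlip x hx y hy).trans (mul_assoc _ _ _).symm.le).continuousOn
  have hex := OPF.exists_isEquilibrium (G := G) (α := α) (hne t) (hcompact t) (hconvex t)
    (hf.contDiff t) hcont
  refine ⟨hex, fun s hs => ?_, fun _ hC3 => ?_⟩
  · obtain ⟨h1, h2⟩ := (hiff s).1 hs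
    exact ⟨by rwa [← h2] at h1, h2⟩
  · obtain ⟨s, hs⟩ := hex
    refine ⟨s, hs, fun s' hs' => ?_⟩
    obtain ⟨h1, h2⟩ := (hiff s).1 hs
    obtain ⟨h1', h2'⟩ := (hiff s').1 hs'
    suffices h : s'.1 = s.1 from Prod.ext h (by rw [h2, h2', h])
    have hx : s.1 ∈ D.feasible t := h1 ▸ OPF.proj_mem hne' hcl' hcv' _
    have hx' : s'.1 ∈ D.feasible t := h1' ▸ OPF.proj_mem hne' hcl' hcv' _
    by_contra hxx
    have hpos : 0 < ‖s'.1 - s.1‖ := norm_pos_iff.2 (sub_ne_zero.2 hxx)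
    set U' := u.vec (D.voltage G t s'.1) (D.d t)
    set U := u.vec (D.voltage G t s.1) (D.d t)
    have hU : ‖U' - U‖ ≤ (⨆ i, L i) * (‖G.A‖ * ‖s'.1 - s.1‖) := hlip _ hx' _ hx
    have hgrad := OPF.norm_sub_smul_le hα.le (hf.strong t _ hx' _ hx) (hf.smooth t _ hx' _ hx)
      (sub_ne_zero.2 hxx)
    have hle : ‖s'.1 - s.1‖ ≤ √(1 - 2 * α * m + α ^ 2 * ξ ^ 2) * ‖s'.1 - s.1‖
        + (⨆ i, L i) * (α * ‖G.A‖) * ‖s'.1 - s.1‖ := by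
      calc ‖s'.1 - s.1‖
          ≤ ‖(s'.1 - α • (D.grad t s'.1 + U')) - (s.1 - α • (D.grad t s.1 + U))‖ := by
            conv_lhs => rw [h1, h1']
            exact OPF.norm_proj_sub_proj_le hne' hcl' hcv' _ _
        _ = ‖(s'.1 - s.1 - α • (D.grad t s'.1 - D.grad t s.1)) - α • (U' - U)‖ := by
            congr 1
            module
        _ ≤ ‖s'.1 - s.1 - α • (D.grad t s'.1 - D.grad t s.1)‖ + α * ‖U' - U‖ := by
            refine (norm_sub_le _ _).trans_eq ?_
            rw [norm_smul, Real.norm_of_nonneg hα.le]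
        _ ≤ _ := by
            refine add_le_add hgrad ((mul_le_mul_of_nonneg_left hU hα.le).trans_eq ?_)
            ring
    -- C3 makes the total factor in `hle` less than one, against `hpos`.
    nlinarith
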